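/- For $0<q<1$ put $(a;q)_n=\prod_{k=0}^{n-1}(1-aq^k)$, $(a;q)_\infty=\prod_{k\ge 0}(1-aq^k)$ and $\Gamma_q(x)=(1-q)^{1-x}\,(q;q)_\infty/(q^x;q)_\infty$; let $(a)_n=a(a+1)\cdots(a+n-1)$. Then for every real $q$ with $0<q<1$ the following three series converge absolutely and $$\sum_{n\geq 0} \frac{(-1)^n q^{n^2} (q^{2 n+1}-4 q^{4 n+1}+q^{6 n+1}+q^{8 n+2}+1) (q;q^2)_n^6}{(q^{2 n+1}+1) (q^2;q^2)_{2 n} (q^2;q^2)_n^4} = \frac{(1-q^2)^2}{\Gamma_{q^2}(1/2)^4},$$ $$\sum_{n\geq 0} \frac{(-1)^n q^{5 n^2} P_1(n) (q;q^2)_n^{10}}{(q^{2 n+1}+1)^5 (q^2;q^2)_{2 n}^5} = \frac{(1-q^2)^2}{\Gamma_{q^2}(1/2)^4},$$ $$\sum_{n\geq 0} \frac{q^{2 n^2} P_2(n) (q;q^2)_{2 n} (q;q^2)_n^6}{(q^{2 n+1}+1)^3 (q^2;q^2)_n^2 (q^2;q^2)_{2 n}^3} = \frac{(1-q^2)^2}{\Gamma_{q^2}(1/2)^4},$$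 where $P_1(n) = 5 q^{2 n+1}+10 q^{4 n+2}-5 q^{6 n+1}+10 q^{6 n+3}-15 q^{8 n+2}+5 q^{8 n+4}+q^{10 n+1}-24 q^{10 n+3}+q^{10 n+5}+5 q^{12 n+2}-15 q^{12 n+4}+10 q^{14 n+3}-5 q^{14 n+5}+10 q^{16 n+4}+5 q^{18 n+5}+q^{20 n+6}+1$ and $P_2(n) = 3 q^{2 n+1}-3 q^{4 n+1}+3 q^{4 n+2}-2 q^{6 n+1}-3 q^{6 n+2}+q^{6 n+3}+q^{8 n+1}-3 q^{8 n+2}-2 q^{8 n+3}+3 q^{10 n+2}-3 q^{10 n+3}+3 q^{12 n+3}+q^{14 n+4}+1$. These are respective $q$-analogues of the Ramanujan-type formulas $$\sum_{n\geq 0} \frac{(-1)^n}{2^{2n}} \frac{(\frac{1}{2})_n^5}{(1)_n^5} (20n^2+8n+1) = \frac{8}{\pi^2},\qquad \sum_{n\geq 0} \frac{(-1)^n}{2^{10n}} \frac{(\frac{1}{2})_n^5}{(1)_n^5} (820n^2+180n+13) = \frac{128}{\pi^2},$$ $$\sum_{n\geq 0} \Big(\frac{1}{2^4}\Big)^n \frac{(\frac{1}{2})_n^3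 (\frac{1}{4})_n (\frac{3}{4})_n}{(1)_n^5} (120n^2 + 34n+3) = \frac{32}{\pi^2}$$ (which are known and not part of the claim) in the following sense: after multiplying the three $q$-identities by $8/(1-q^2)^2$, $128/(1-q^2)^2$ and $32/(1-q^2)^2$ respectively, for each fixed $n\ge 0$ the $n$-th summand on the left converges, as $q\to 1^-$, to the $n$-th summand of the respective classical series, and the right-hand side converges to $8/\pi^2$, $128/\pi^2$ and $32/\pi^2$ respectively. -/

import Mathlib

open Filter Topology

noncomputable section

namespace QRamanujan

/-- The finite `q`-shifted factorial `(a; q)_n = ∏_{0 ≤ k < n} (1 - a q^k)`. -/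
def qPoch (a q : ℝ) (n : ℕ) : ℝ := ∏ k ∈ Finset.range n, (1 - a * q ^ k)

/-- The infinite `q`-shifted factorial `(a; q)_∞ = ∏_{k ≥ 0} (1 - a q^k)`
(the product converges for `|q| < 1`). -/
def qPochInf (a q : ℝ) : ℝ := ∏' k : ℕ, (1 - a * q ^ k)

/-- The `q`-gamma function `Γ_q(x) = (1 - q)^(1 - x) (q; q)_∞ / (q^x; q)_∞`, for `0 < q < 1`. -/
def qGamma (q x : ℝ) : ℝ := (1 - q) ^ (1 - x) * (qPochInf q q / qPochInf (q ^ x) q)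

/-- The classical shifted factorial `(a)_n = a (a + 1) ⋯ (a + n - 1)`. -/
def poch (a : ℝ) (n : ℕ) : ℝ := (ascPochhammer ℝ n).eval a

/-- The polynomial factor of the second `q`-series. -/
def P₁ (q : ℝ) (n : ℕ) : ℝ :=
  5 * q ^ (2 * n + 1) + 10 * q ^ (4 * n + 2) - 5 * q ^ (6 * n + 1) + 10 * q ^ (6 * n + 3)
    - 15 * q ^ (8 * n + 2) + 5 * q ^ (8 * n + 4) + q ^ (10 * n + 1) - 24 * q ^ (10 * n + 3)
    + q ^ (10 * n + 5) + 5 * q ^ (12 * n + 2) - 15 * q ^ (12 * n + 4) + 10 * q ^ (14 * n + 3)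
    - 5 * q ^ (14 * n + 5) + 10 * q ^ (16 * n + 4) + 5 * q ^ (18 * n + 5) + q ^ (20 * n + 6) + 1

/-- The polynomial factor of the third `q`-series. -/
def P₂ (q : ℝ) (n : ℕ) : ℝ :=
  3 * q ^ (2 * n + 1) - 3 * q ^ (4 * n + 1) + 3 * q ^ (4 * n + 2) - 2 * q ^ (6 * n + 1)
    - 3 * q ^ (6 * n + 2) + q ^ (6 * n + 3) + q ^ (8 * n + 1) - 3 * q ^ (8 * n + 2)
    - 2 * q ^ (8 * n + 3) + 3 * q ^ (10 * n + 2) - 3 * q ^ (10 * n + 3) + 3 * q ^ (12 * n + 3)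
    + q ^ (14 * n + 4) + 1

/-- The summand of the first `q`-series. -/
def S₁ (q : ℝ) (n : ℕ) : ℝ :=
  (-1) ^ n * q ^ (n ^ 2)
    * (q ^ (2 * n + 1) - 4 * q ^ (4 * n + 1) + q ^ (6 * n + 1) + q ^ (8 * n + 2) + 1)
    * qPoch q (q ^ 2) n ^ 6
    / ((q ^ (2 * n + 1) + 1) * qPoch (q ^ 2) (q ^ 2) (2 * n) * qPoch (q ^ 2) (q ^ 2) n ^ 4)

/-- The summand of the second `q`-series. -/
def S₂ (q : ℝ) (n : ℕ) : ℝ :=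
  (-1) ^ n * q ^ (5 * n ^ 2) * P₁ q n * qPoch q (q ^ 2) n ^ 10
    / ((q ^ (2 * n + 1) + 1) ^ 5 * qPoch (q ^ 2) (q ^ 2) (2 * n) ^ 5)

/-- The summand of the third `q`-series. -/
def S₃ (q : ℝ) (n : ℕ) : ℝ :=
  q ^ (2 * n ^ 2) * P₂ q n * qPoch q (q ^ 2) (2 * n) * qPoch q (q ^ 2) n ^ 6
    / ((q ^ (2 * n + 1) + 1) ^ 3 * qPoch (q ^ 2) (q ^ 2) n ^ 2
      * qPoch (q ^ 2) (q ^ 2) (2 * n) ^ 3)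

/-- The summand of the classical series with value `8 / π²`. -/
def R₁ (n : ℕ) : ℝ :=
  (-1) ^ n / 2 ^ (2 * n) * (poch (1 / 2) n ^ 5 / poch 1 n ^ 5) * (20 * (n : ℝ) ^ 2 + 8 * n + 1)

/-- The summand of the classical series with value `128 / π²`. -/
def R₂ (n : ℕ) : ℝ :=
  (-1) ^ n / 2 ^ (10 * n) * (poch (1 / 2) n ^ 5 / poch 1 n ^ 5)
    * (820 * (n : ℝ) ^ 2 + 180 * n + 13)

/-- The summand of the classical series with value `32 / π²`. -/
def R₃ (n : ℕ) : ℝ :=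
  (1 / 2 ^ 4) ^ n * (poch (1 / 2) n ^ 3 * poch (1 / 4) n * poch (3 / 4) n / poch 1 n ^ 5)
    * (120 * (n : ℝ) ^ 2 + 34 * n + 3)

end QRamanujan

end

noncomputable section

namespace QRamanujan

/-! Each series is the boundary row `k = 0` of a WZ pair `F n k = W n k * f`, `H n k = W n k * g`,
where `W` is a product of shifted factorials and `f`, `g` are rational in `x = q ^ (2 * n)`, `y = q
^ (2 * k)`. Double telescoping (`hasSum_of_wz`) moves `∑ H n 0` to the limit of `H 0 k` as `k → ∞`:
`F 0 k = 0` because `f` contains `1 - x ^ 2`, while the Gaussian power of `q` in `W` kills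
everything else. All three weights have the same row `n = 0`, namely `((q;q²)_k / (q²;q²)_k) ^ 4`,
so the three sums coincide. The second pair comes from the first by `k ↦ n + k`: `W₂ q n k = W₁ q n
(n + k)`, and `f` changes by `y ↦ x * y`. Divided by `W n k`, the WZ equations become the polynomial
identities `cert₁_wz`, `cert₂_wz`, `cert₃_wz`.

For the termwise limits, the powers of `1 - q` in the shifted factorials cancel, and the double zero
of the polynomial factor at `q = 1` cancels `(1 - q ^ 2) ^ 2`. For the right-hand side, `Γ_{q²}(1/2)
^ 2` is `1 + q` times a `q`-Wallis product whose partial products increase in `N` and are bounded by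
the classical ones; this gives the limit `π` (`tendsto_qGamma_half_sq`). -/

/-! ### Telescoping of a WZ pair -/

/-- Summing a WZ pair `F n k - F (n + 1) k = H n k - H n (k + 1)` whose first row `F 0` vanishes
evaluates the boundary series `∑ H n 0`. -/
theorem hasSum_of_wz {F H : ℕ → ℕ → ℝ} {C M r : ℝ} (hr0 : 0 ≤ r) (hr1 : r < 1)
    (hwz : ∀ n k, F n k - F (n + 1) k = H n k - H n (k + 1))
    (hF0 : ∀ k, F 0 k = 0)
    (hF : ∀ n k, 1 ≤ n → |F n k| ≤ M * r ^ n * r ^ k)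
    (hH0 : Tendsto (H 0) atTop (𝓝 C))
    (hH : ∀ n k, 1 ≤ n → |H n k| ≤ M * r ^ n * r ^ k) :
    HasSum (fun n => H n 0) C := by
  have hsum : Summable (fun n => H n 0) := by
    -- The geometric bound holds only for `n ≥ 1`, since row `0` has the limit `C`, which need not
    -- vanish; dropping one term does not affect summability.
    rw [← summable_nat_add_iff 1]
    refine Summable.of_norm_bounded (g := fun n => M * r * r ^ n)
      ((summable_geometric_of_lt_one hr0 hr1).mul_left _) fun n => ?_
    have := hH (n + 1) 0 (by omega)
    rw [Real.norm_eq_abs]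
    calc _ ≤ _ := this
      _ = _ := by ring
  have hHlim : ∀ n, 1 ≤ n → Tendsto (H n) atTop (𝓝 0) := fun n hn => by
    refine squeeze_zero_norm (fun k => hH n k hn) ?_
    simpa using (tendsto_pow_atTop_nhds_zero_of_lt_one hr0 hr1).const_mul (M * r ^ n)
  have hfin : ∀ N K, ∑ n ∈ Finset.range N, H n 0
      = ∑ n ∈ Finset.range N, H n K - ∑ k ∈ Finset.range K, F N k := fun N K => by
    have h1 : ∑ n ∈ Finset.range N, ∑ k ∈ Finset.range K, (F n k - F (n + 1) k)
        = ∑ n ∈ Finset.range N, (H n 0 - H n K) := by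
      refine Finset.sum_congr rfl fun n _ => ?_
      rw [← Finset.sum_range_sub']
      exact Finset.sum_congr rfl fun k _ => hwz n k
    have h2 : ∑ n ∈ Finset.range N, ∑ k ∈ Finset.range K, (F n k - F (n + 1) k)
        = - ∑ k ∈ Finset.range K, F N k := by
      rw [Finset.sum_comm, ← Finset.sum_neg_distrib]
      refine Finset.sum_congr rfl fun k _ => ?_
      rw [Finset.sum_range_sub' (fun n => F n k), hF0, zero_sub]
    rw [Finset.sum_sub_distrib] at h1
    linarith
  -- As `K → ∞` only the row `n = 0` survives in the far boundary.
  have hHsum : ∀ N, Tendsto (fun K => ∑ n ∈ Finset.range (N + 1), H n K) atTop (𝓝 C) := by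
    intro N
    have h := tendsto_finsetSum (f := fun n K => H n K) (a := fun n => if n = 0 then C else 0)
      (Finset.range (N + 1)) (x := atTop) fun n _ => by
        rcases Nat.eq_zero_or_pos n with rfl | hn
        · simpa using hH0
        · simpa [hn.ne'] using hHlim n hn
    simpa using h
  -- By `hfin` the partial sum differs from the far boundary by `∑ k, F (N + 1) k`, a geometric tail
  -- bounded uniformly in `K`. The index `N + 1` makes row `0` always present and the bound on `F`
  -- applicable.
  have hbound : ∀ N, |∑ n ∈ Finset.range (N + 1), H n 0 - C| ≤ M * r ^ (N + 1) * (1 - r)⁻¹ := by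
    intro N
    have hlim := (((hHsum N).sub_const C).abs)
    have hlim' : Tendsto (fun K => |∑ n ∈ Finset.range (N + 1), H n 0 - C|
        - |∑ n ∈ Finset.range (N + 1), H n K - C|) atTop
        (𝓝 (|∑ n ∈ Finset.range (N + 1), H n 0 - C| - |C - C|)) := hlim.const_sub _
    rw [sub_self, abs_zero, sub_zero] at hlim'
    refine le_of_tendsto' hlim' fun K => ?_
    have hM : 0 ≤ M * r ^ (N + 1) := by
      have := (abs_nonneg _).trans (hF (N + 1) 0 (by omega))
      simpa using this
    calc _ ≤ |∑ k ∈ Finset.range K, F (N + 1) k| := by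
          rw [hfin (N + 1) K]
          have := abs_sub_abs_le_abs_sub (∑ n ∈ Finset.range (N + 1), H n K
            - ∑ k ∈ Finset.range K, F (N + 1) k - C) (∑ n ∈ Finset.range (N + 1), H n K - C)
          refine this.trans (le_of_eq ?_)
          rw [← abs_neg]
          congr 1
          ring
      _ ≤ ∑ k ∈ Finset.range K, |F (N + 1) k| := Finset.abs_sum_le_sum_abs _ _
      _ ≤ ∑ k ∈ Finset.range K, M * r ^ (N + 1) * r ^ k :=
          Finset.sum_le_sum fun k _ => hF _ _ (by omega)
      _ = M * r ^ (N + 1) * ∑ k ∈ Finset.range K, r ^ k := by rw [Finset.mul_sum]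
      _ ≤ M * r ^ (N + 1) * (1 - r)⁻¹ := by
          gcongr
          rw [← tsum_geometric_of_lt_one hr0 hr1]
          exact (summable_geometric_of_lt_one hr0 hr1).sum_le_tsum _ fun _ _ => pow_nonneg hr0 _
  have hlim : Tendsto (fun N => ∑ n ∈ Finset.range (N + 1), H n 0) atTop (𝓝 C) := by
    rw [tendsto_iff_norm_sub_tendsto_zero]
    refine squeeze_zero (fun _ => norm_nonneg _) hbound ?_
    have := ((tendsto_pow_atTop_nhds_zero_of_lt_one hr0 hr1).comp
      (tendsto_add_atTop_nat 1)).const_mul M |>.mul_const (1 - r)⁻¹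
    simpa using this
  have := tendsto_nhds_unique (hsum.hasSum.tendsto_sum_nat.comp (tendsto_add_atTop_nat 1)) hlim
  rw [← this]
  exact hsum.hasSum

/-! ### Rational certificates -/

/-- The numerator of the rational certificate for `S₁`, in `x = q ^ (2 * n)`, `y = q ^ (2 * k)`. -/
def cert₁ (q x y : ℝ) : ℝ :=
    (1 + q * x) + (-4 * q * x ^ 2) * y + (q * x ^ 3 + q ^ 2 * x ^ 4) * y ^ 2

/-- The numerator of the rational certificate for `S₂`, in `x = q ^ (2 * n)`, `y = q ^ (2 * k)`. -/
def cert₂ (q x y : ℝ) : ℝ :=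
    (1 + q * x) + (-4 * q ^ 2 * x ^ 2 - 4 * q * x ^ 3 - 4 * q ^ 3 * x ^ 3) * y + (-q * x ^ 3 + 5
    * q ^ 2 * x ^ 4 + 6 * q ^ 4 * x ^ 4 + q * x ^ 5 + 6 * q ^ 3 * x ^ 5 + 6 * q ^ 5 * x ^ 5 + q
    ^ 2 * x ^ 6 + 10 * q ^ 4 * x ^ 6 - 5 * q ^ 5 * x ^ 7 + q ^ 6 * x ^ 8) * y ^ 2 + (-4 * q ^ 6
    * x ^ 6 - 4 * q ^ 3 * x ^ 7 - 24 * q ^ 5 * x ^ 7 - 4 * q ^ 7 * x ^ 7 - 4 * q ^ 4 * x ^ 8) *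
    y ^ 3 + (q ^ 4 * x ^ 6 - 5 * q ^ 5 * x ^ 7 + 10 * q ^ 6 * x ^ 8 + q ^ 8 * x ^ 8 + 6 * q ^ 5
    * x ^ 9 + 6 * q ^ 7 * x ^ 9 + q ^ 9 * x ^ 9 + 6 * q ^ 6 * x ^ 10 + 5 * q ^ 8 * x ^ 10 - q ^
    9 * x ^ 11) * y ^ 4 + (-4 * q ^ 7 * x ^ 11 - 4 * q ^ 9 * x ^ 11 - 4 * q ^ 8 * x ^ 12) * y ^
    5 + (q ^ 9 * x ^ 13 + q ^ 10 * x ^ 14) * y ^ 6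

/-- The numerator of the rational certificate for `S₃`, in `x = q ^ (2 * n)`, `y = q ^ (2 * k)`. -/
def cert₃ (q x y : ℝ) : ℝ :=
    (1 + q * x) + (-2 * q * x ^ 2 - 2 * q ^ 2 * x ^ 2 - 2 * q * x ^ 3 - 2 * q ^ 3 * x ^ 3) * y +
    (-q * x ^ 2 + 3 * q ^ 2 * x ^ 3 + q * x ^ 4 + q ^ 2 * x ^ 4 + q ^ 3 * x ^ 4 + q ^ 4 * x ^ 4
    + q ^ 2 * x ^ 5 + q ^ 3 * x ^ 5 + q ^ 4 * x ^ 5 + q ^ 5 * x ^ 5 + 3 * q ^ 4 * x ^ 6 - q ^ 5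
    * x ^ 7) * y ^ 2 + (-2 * q ^ 3 * x ^ 6 - 2 * q ^ 5 * x ^ 6 - 2 * q ^ 4 * x ^ 7 - 2 * q ^ 5 *
    x ^ 7) * y ^ 3 + (q ^ 5 * x ^ 8 + q ^ 6 * x ^ 9) * y ^ 4

/-- The WZ equation divided by `W₁ q n k` and cleared of denominators. One factor of `(1 - q * x) ^
6` has cancelled against `1 - q ^ 2 * x ^ 2 = (1 - q * x) * (1 + q * x)`, and `1 - q ^ 4 * x ^ 2`
against the factor `1 - x ^ 2` of `f` shifted to `n + 1`. -/
theorem cert₁_wz (q x y : ℝ) :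
    (1 + q * x) * (1 - x ^ 2) * (1 - q * x * y ^ 2) * (1 - q ^ 2 * x * y) ^ 4
      + q * x * (1 - q * x) ^ 5 * (1 - q ^ 3 * x * y ^ 2) * y ^ 2
    = (1 - q ^ 2 * x * y) ^ 4 * cert₁ q x y
      - x ^ 2 * (1 - q * y) ^ 4 * cert₁ q x (q ^ 2 * y) := by
  unfold cert₁
  ring

theorem cert₂_wz (q x y : ℝ) :
    (1 + q * x) * (1 - x ^ 2) * (1 - q * x ^ 3 * y ^ 2) * (1 - q ^ 2 * x ^ 2 * y) ^ 4
        * (1 - q ^ 4 * x ^ 2 * y) ^ 4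
      + q ^ 5 * x ^ 5 * (1 - q * x) ^ 5 * (1 - q * x * y) ^ 4 * (1 - q ^ 7 * x ^ 3 * y ^ 2) * y ^ 2
    = (1 - q ^ 4 * x ^ 2 * y) ^ 4 * cert₂ q x y
      - x ^ 2 * (1 - q * x * y) ^ 4 * cert₂ q x (q ^ 2 * y) := by
  unfold cert₂
  ring

theorem cert₃_wz (q x y : ℝ) :
    (1 + q * x) * (1 - x ^ 2) * (1 - q * x ^ 2 * y ^ 2) * (1 - q ^ 2 * x ^ 2 * y) ^ 2
        * (1 - q ^ 4 * x ^ 2 * y) ^ 2 * (1 - q ^ 2 * x * y) ^ 2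
      - q ^ 2 * x ^ 2 * (1 - q * x) ^ 3 * (1 - q * x ^ 2) * (1 - q ^ 3 * x ^ 2)
        * (1 - q * x * y) ^ 2 * (1 - q ^ 5 * x ^ 2 * y ^ 2) * y ^ 2
    = (1 - q ^ 4 * x ^ 2 * y) ^ 2 * (1 - q ^ 2 * x * y) ^ 2 * cert₃ q x y
      - x ^ 2 * (1 - q * x * y) ^ 2 * (1 - q * y) ^ 2 * cert₃ q x (q ^ 2 * y) := by
  unfold cert₃
  ring

/-- At `y = 1` the denominator of `g` is `(1 + q * x) ^ 5 * (1 - q * x) ^ 4`; the extra factor split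
off here cancels its second part and leaves the denominator of `S₂`. -/
theorem cert₂_one (q : ℝ) (n : ℕ) :
    cert₂ q (q ^ (2 * n)) 1 = P₁ q n * (1 - q * q ^ (2 * n)) ^ 4 := by
  unfold cert₂ P₁
  ring

theorem cert₃_one (q : ℝ) (n : ℕ) :
    cert₃ q (q ^ (2 * n)) 1 = P₂ q n * (1 - q * q ^ (2 * n)) ^ 2 := by
  unfold cert₃ P₂
  ring

/-! ### Shifted factorials -/

theorem qPoch_zero (a q : ℝ) : qPoch a q 0 = 1 := by simp [qPoch]

theorem qPoch_succ (a q : ℝ) (n : ℕ) : qPoch a q (n + 1) = qPoch a q n * (1 - a * q ^ n) :=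
  Finset.prod_range_succ _ _

section

variable {a q : ℝ}

theorem one_sub_mul_pow_pos (ha0 : 0 ≤ a) (ha1 : a < 1) (hq0 : 0 ≤ q) (hq1 : q < 1) (k : ℕ) :
    0 < 1 - a * q ^ k := by
  have h1 : q ^ k ≤ 1 := pow_le_one₀ hq0 hq1.le
  have := mul_le_of_le_one_right ha0 h1
  linarith

theorem qPoch_pos (ha0 : 0 ≤ a) (ha1 : a < 1) (hq0 : 0 ≤ q) (hq1 : q < 1) (n : ℕ) :
    0 < qPoch a q n :=
  Finset.prod_pos fun k _ => one_sub_mul_pow_pos ha0 ha1 hq0 hq1 k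

theorem qPoch_le_one (ha0 : 0 ≤ a) (ha1 : a < 1) (hq0 : 0 ≤ q) (hq1 : q < 1) (n : ℕ) :
    qPoch a q n ≤ 1 :=
  Finset.prod_le_one (fun k _ => (one_sub_mul_pow_pos ha0 ha1 hq0 hq1 k).le) fun k _ => by
    have : 0 ≤ a * q ^ k := by positivity
    linarith

theorem tendsto_qPoch (hq0 : 0 ≤ q) (hq1 : q < 1) :
    Tendsto (qPoch a q) atTop (𝓝 (qPochInf a q)) := by
  have hs : Summable fun k : ℕ => ‖-(a * q ^ k)‖ :=
    ((summable_geometric_of_lt_one hq0 hq1).mul_left a).neg.norm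
  have := (multipliable_one_add_of_summable hs).hasProd.tendsto_prod_nat
  simp only [← sub_eq_add_neg] at this
  exact this

/-- With `a = q ^ 2`, this gives one positive lower bound for every shifted factorial in the
denominators of the weights, uniformly in the indices. -/
theorem qPochInf_le (ha0 : 0 ≤ a) (ha1 : a < 1) (hq0 : 0 ≤ q) (hq1 : q < 1) (n : ℕ) :
    qPochInf a q ≤ qPoch a q n := by
  refine Antitone.le_of_tendsto (antitone_nat_of_succ_le fun n => ?_) (tendsto_qPoch hq0 hq1) n
  rw [qPoch_succ]
  refine mul_le_of_le_one_right (qPoch_pos ha0 ha1 hq0 hq1 n).le ?_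
  have : 0 ≤ a * q ^ n := by positivity
  linarith

theorem qPochInf_pos (ha0 : 0 ≤ a) (ha1 : a < 1) (hq0 : 0 ≤ q) (hq1 : q < 1) :
    0 < qPochInf a q := by
  refine lt_of_le_of_ne
    (ge_of_tendsto' (tendsto_qPoch hq0 hq1) fun n => (qPoch_pos ha0 ha1 hq0 hq1 n).le) ?_
  have hs : Summable fun k : ℕ => ‖-(a * q ^ k)‖ :=
    ((summable_geometric_of_lt_one hq0 hq1).mul_left a).neg.norm
  -- Positive partial products only give a nonnegative limit; absolute convergence of `∑ a * q ^ k`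
  -- excludes `0`.
  have := tprod_one_add_ne_zero_of_summable
    (fun k => by simpa [← sub_eq_add_neg] using (one_sub_mul_pow_pos ha0 ha1 hq0 hq1 k).ne') hs
  simp only [← sub_eq_add_neg] at this
  exact this.symm

end

theorem qGamma_half {q : ℝ} (hq0 : 0 < q) :
    qGamma (q ^ 2) (1 / 2)
      = (1 - q ^ 2) ^ (1 / 2 : ℝ) * (qPochInf (q ^ 2) (q ^ 2) / qPochInf q (q ^ 2)) := by
  have : (q ^ 2) ^ (1 / 2 : ℝ) = q := by
    rw [← Real.sqrt_eq_rpow, Real.sqrt_sq hq0.le]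
  rw [qGamma, this]
  norm_num

theorem qGamma_half_sq {q : ℝ} (hq0 : 0 < q) (hq1 : q < 1) :
    qGamma (q ^ 2) (1 / 2) ^ 2
      = (1 - q ^ 2) * (qPochInf (q ^ 2) (q ^ 2) / qPochInf q (q ^ 2)) ^ 2 := by
  have h : 0 ≤ 1 - q ^ 2 := by nlinarith
  rw [qGamma_half hq0, mul_pow, ← Real.sqrt_eq_rpow, Real.sq_sqrt h]

theorem sq_div_qGamma_half_pow {q : ℝ} (hq0 : 0 < q) (hq1 : q < 1) :
    (1 - q ^ 2) ^ 2 / qGamma (q ^ 2) (1 / 2) ^ 4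
      = (qPochInf q (q ^ 2) / qPochInf (q ^ 2) (q ^ 2)) ^ 4 := by
  have h : 0 < 1 - q ^ 2 := by nlinarith
  have hu := (qPochInf_pos hq0.le hq1 (sq_nonneg q) (by nlinarith)).ne'
  have hv := (qPochInf_pos (sq_nonneg q) (by nlinarith) (sq_nonneg q) (by nlinarith : q ^ 2 < 1)).ne'
  rw [show qGamma (q ^ 2) (1 / 2) ^ 4 = (qGamma (q ^ 2) (1 / 2) ^ 2) ^ 2 by ring,
    qGamma_half_sq hq0 hq1]
  field_simp

/-! ### The three series -/

/-- Summation of a WZ pair of the form `F n k = W n k * f (q ^ (2 * n)) (q ^ (2 * k))`,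
`H n k = W n k * g (q ^ (2 * n)) (q ^ (2 * k))`. -/
theorem hasSum_of_wz_weight {q C D : ℝ} (hq0 : 0 < q) (hq1 : q < 1) {W : ℕ → ℕ → ℝ}
    {f g : ℝ → ℝ → ℝ}
    (hwz : ∀ n k, W n k * f (q ^ (2 * n)) (q ^ (2 * k))
        - W (n + 1) k * f (q ^ (2 * (n + 1))) (q ^ (2 * k))
      = W n k * g (q ^ (2 * n)) (q ^ (2 * k))
        - W n (k + 1) * g (q ^ (2 * n)) (q ^ (2 * (k + 1))))
    (hW : ∀ n k, 1 ≤ n → |W n k| ≤ D * q ^ n * q ^ k)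
    (hW0 : Tendsto (W 0) atTop (𝓝 C))
    (hf : ContinuousOn (fun z : ℝ × ℝ => f z.1 z.2) (Set.Icc 0 1 ×ˢ Set.Icc 0 1))
    (hg : ContinuousOn (fun z : ℝ × ℝ => g z.1 z.2) (Set.Icc 0 1 ×ˢ Set.Icc 0 1))
    (hf1 : ∀ y, f 1 y = 0) (hg1 : g 1 0 = 1) :
    HasSum (fun n => W n 0 * g (q ^ (2 * n)) 1) C := by
  have hK : IsCompact (Set.Icc (0 : ℝ) 1 ×ˢ Set.Icc (0 : ℝ) 1) := isCompact_Icc.prod isCompact_Icc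
  obtain ⟨A, hA⟩ := hK.exists_bound_of_continuousOn hf
  obtain ⟨B, hB⟩ := hK.exists_bound_of_continuousOn hg
  have hmem : ∀ n k : ℕ, ((q ^ (2 * n), q ^ (2 * k)) : ℝ × ℝ) ∈ Set.Icc (0 : ℝ) 1 ×ˢ Set.Icc (0 : ℝ) 1 :=
    fun n k => ⟨⟨by positivity, pow_le_one₀ hq0.le hq1.le⟩,
      ⟨by positivity, pow_le_one₀ hq0.le hq1.le⟩⟩
  have hbd : ∀ (φ : ℝ → ℝ → ℝ) (E : ℝ), E ≤ |A| + |B| →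
      (∀ z ∈ Set.Icc (0 : ℝ) 1 ×ˢ Set.Icc (0 : ℝ) 1, ‖φ z.1 z.2‖ ≤ E) → ∀ n k : ℕ, 1 ≤ n →
      |W n k * φ (q ^ (2 * n)) (q ^ (2 * k))| ≤ D * (|A| + |B|) * q ^ n * q ^ k := by
    intro φ E hE hφ n k hn
    have h1 := hW n k hn
    rw [abs_mul]
    calc _ ≤ D * q ^ n * q ^ k * (|A| + |B|) :=
          mul_le_mul h1 ((hφ _ (hmem n k)).trans hE) (abs_nonneg _) ((abs_nonneg _).trans h1)
      _ = _ := by ring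
  have hmain := hasSum_of_wz (F := fun n k => W n k * f (q ^ (2 * n)) (q ^ (2 * k)))
    (H := fun n k => W n k * g (q ^ (2 * n)) (q ^ (2 * k))) (C := C) (M := D * (|A| + |B|))
    hq0.le hq1 hwz (fun k => by simp [hf1])
    (hbd f A ((le_abs_self A).trans (le_add_of_nonneg_right (abs_nonneg B))) hA)
    -- Row `0` of `H` is `W 0 k * g 1 (q ^ (2 * k))`, which tends to `C * g 1 0 = C`. Continuity is
    -- only known on the unit square, hence the limit within it.
    (by
      have hy : Tendsto (fun k : ℕ => q ^ (2 * k)) atTop (𝓝 0) := by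
        simp only [pow_mul]
        exact tendsto_pow_atTop_nhds_zero_of_lt_one (sq_nonneg q) (by nlinarith)
      have hz : Tendsto (fun k : ℕ => ((1, q ^ (2 * k)) : ℝ × ℝ)) atTop
          (𝓝[Set.Icc (0 : ℝ) 1 ×ˢ Set.Icc (0 : ℝ) 1] (1, 0)) :=
        tendsto_nhdsWithin_iff.2 ⟨tendsto_const_nhds.prodMk_nhds hy,
          Eventually.of_forall fun k => by simpa using hmem 0 k⟩
      have := hW0.mul ((hg (1, 0) (by simp)).tendsto.comp hz)
      simpa [hg1, Function.comp_def] using this)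
    (hbd g B ((le_abs_self B).trans (le_add_of_nonneg_left (abs_nonneg A))) hB)
  simpa using hmain

theorem abs_le_of_eq_mul_div {s t P Q δ : ℝ} {m : ℕ} (ht : 0 ≤ t) (hP0 : 0 ≤ P) (hP1 : P ≤ 1)
    (hδ : 0 < δ) (hQ : δ ^ m ≤ Q) (hs : |s| = 1) {w : ℝ} (hw : w = s * t * P / Q) :
    |w| ≤ (δ ^ m)⁻¹ * t := by
  have hQ0 : 0 < Q := (pow_pos hδ m).trans_le hQ
  rw [hw, abs_div, abs_mul, abs_mul, hs, abs_of_nonneg ht, abs_of_nonneg hP0, abs_of_pos hQ0,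
    one_mul, div_eq_inv_mul]
  have : Q⁻¹ ≤ (δ ^ m)⁻¹ := inv_anti₀ (by positivity) hQ
  exact mul_le_mul this (mul_le_of_le_one_right ht hP1) (by positivity) (by positivity)

/-- A lower exponent bound which turns the Gaussian decay of the weights into geometric decay. -/
theorem pow_le_pow_mul_pow {q : ℝ} (hq0 : 0 < q) (hq1 : q < 1) {e n k : ℕ} (h : n + k ≤ e) :
    q ^ e ≤ q ^ n * q ^ k := by
  rw [← pow_add]
  exact pow_le_pow_of_le_one hq0.le hq1.le h

/-- The common weight of the WZ pair summing `S₁`. -/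
def W₁ (q : ℝ) (n k : ℕ) : ℝ :=
  (-1) ^ n * q ^ (n ^ 2 + 4 * n * k) * (qPoch q (q ^ 2) n ^ 6 * qPoch q (q ^ 2) k ^ 4)
    / (qPoch (q ^ 2) (q ^ 2) (n + k) ^ 4 * qPoch (q ^ 2) (q ^ 2) (2 * n))

/-- The common weight of the WZ pair summing `S₂`. -/
def W₂ (q : ℝ) (n k : ℕ) : ℝ :=
  (-1) ^ n * q ^ (5 * n ^ 2 + 4 * n * k)
      * (qPoch q (q ^ 2) n ^ 6 * qPoch q (q ^ 2) (n + k) ^ 4)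
    / (qPoch (q ^ 2) (q ^ 2) (2 * n + k) ^ 4 * qPoch (q ^ 2) (q ^ 2) (2 * n))

/-- The common weight of the WZ pair summing `S₃`. -/
def W₃ (q : ℝ) (n k : ℕ) : ℝ :=
  1 * q ^ (2 * n ^ 2 + 4 * n * k)
      * (qPoch q (q ^ 2) n ^ 4 * qPoch q (q ^ 2) (2 * n) * qPoch q (q ^ 2) (n + k) ^ 2
        * qPoch q (q ^ 2) k ^ 2)
    / (qPoch (q ^ 2) (q ^ 2) (n + k) ^ 2 * qPoch (q ^ 2) (q ^ 2) (2 * n + k) ^ 2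
      * qPoch (q ^ 2) (q ^ 2) (2 * n))

/-- The shift ratios of the weights are rational in `q`, `x = q ^ (2 * n)` and `y = q ^ (2 * k)`;
this reduces the WZ equation to an identity between rational functions. -/
theorem W₁_succ_left (q : ℝ) (n k : ℕ) :
    W₁ q (n + 1) k = W₁ q n k * (-(q * q ^ (2 * n) * (q ^ (2 * k)) ^ 2
        * (1 - q * q ^ (2 * n)) ^ 6)
      / ((1 - q ^ 2 * q ^ (2 * n) * q ^ (2 * k)) ^ 4 * (1 - q ^ 2 * (q ^ (2 * n)) ^ 2)
        * (1 - q ^ 4 * (q ^ (2 * n)) ^ 2))) := by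
  rw [W₁, W₁, show n + 1 + k = n + k + 1 by ring, show 2 * (n + 1) = 2 * n + 1 + 1 by ring,
    div_mul_div_comm]
  simp only [qPoch_succ]
  congr 1 <;> ring

theorem W₁_succ_right (q : ℝ) (n k : ℕ) :
    W₁ q n (k + 1) = W₁ q n k * ((q ^ (2 * n)) ^ 2 * (1 - q * q ^ (2 * k)) ^ 4
      / (1 - q ^ 2 * q ^ (2 * n) * q ^ (2 * k)) ^ 4) := by
  rw [W₁, W₁, show n + (k + 1) = n + k + 1 by ring,
    div_mul_div_comm]
  simp only [qPoch_succ]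
  congr 1 <;> ring

theorem W₂_succ_left (q : ℝ) (n k : ℕ) :
    W₂ q (n + 1) k = W₂ q n k * (-(q ^ 5 * (q ^ (2 * n)) ^ 5 * (q ^ (2 * k)) ^ 2
        * (1 - q * q ^ (2 * n)) ^ 6 * (1 - q * q ^ (2 * n) * q ^ (2 * k)) ^ 4)
      / ((1 - q ^ 2 * (q ^ (2 * n)) ^ 2 * q ^ (2 * k)) ^ 4
        * (1 - q ^ 4 * (q ^ (2 * n)) ^ 2 * q ^ (2 * k)) ^ 4 * (1 - q ^ 2 * (q ^ (2 * n)) ^ 2)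
        * (1 - q ^ 4 * (q ^ (2 * n)) ^ 2))) := by
  rw [W₂, W₂, show 2 * (n + 1) + k = 2 * n + k + 1 + 1 by ring, show n + 1 + k = n + k + 1 by ring,
    show 2 * (n + 1) = 2 * n + 1 + 1 by ring,
    div_mul_div_comm]
  simp only [qPoch_succ]
  congr 1 <;> ring

theorem W₂_succ_right (q : ℝ) (n k : ℕ) :
    W₂ q n (k + 1) = W₂ q n k * ((q ^ (2 * n)) ^ 2 * (1 - q * q ^ (2 * n) * q ^ (2 * k)) ^ 4
      / (1 - q ^ 2 * (q ^ (2 * n)) ^ 2 * q ^ (2 * k)) ^ 4) := by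
  rw [W₂, W₂, show n + (k + 1) = n + k + 1 by ring, show 2 * n + (k + 1) = 2 * n + k + 1 by ring,
    div_mul_div_comm]
  simp only [qPoch_succ]
  congr 1 <;> ring

theorem W₃_succ_left (q : ℝ) (n k : ℕ) :
    W₃ q (n + 1) k = W₃ q n k * (q ^ 2 * (q ^ (2 * n)) ^ 2 * (q ^ (2 * k)) ^ 2
        * (1 - q * q ^ (2 * n)) ^ 4 * (1 - q * (q ^ (2 * n)) ^ 2) * (1 - q ^ 3 * (q ^ (2 * n)) ^ 2)
        * (1 - q * q ^ (2 * n) * q ^ (2 * k)) ^ 2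
      / ((1 - q ^ 2 * q ^ (2 * n) * q ^ (2 * k)) ^ 2
        * (1 - q ^ 2 * (q ^ (2 * n)) ^ 2 * q ^ (2 * k)) ^ 2
        * (1 - q ^ 4 * (q ^ (2 * n)) ^ 2 * q ^ (2 * k)) ^ 2 * (1 - q ^ 2 * (q ^ (2 * n)) ^ 2)
        * (1 - q ^ 4 * (q ^ (2 * n)) ^ 2))) := by
  rw [W₃, W₃, show 2 * (n + 1) + k = 2 * n + k + 1 + 1 by ring, show n + 1 + k = n + k + 1 by ring,
    show 2 * (n + 1) = 2 * n + 1 + 1 by ring,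
    div_mul_div_comm]
  simp only [qPoch_succ]
  congr 1 <;> ring

theorem W₃_succ_right (q : ℝ) (n k : ℕ) :
    W₃ q n (k + 1) = W₃ q n k * ((q ^ (2 * n)) ^ 2 * (1 - q * q ^ (2 * n) * q ^ (2 * k)) ^ 2
        * (1 - q * q ^ (2 * k)) ^ 2
      / ((1 - q ^ 2 * q ^ (2 * n) * q ^ (2 * k)) ^ 2
        * (1 - q ^ 2 * (q ^ (2 * n)) ^ 2 * q ^ (2 * k)) ^ 2)) := by
  rw [W₃, W₃, show n + (k + 1) = n + k + 1 by ring, show 2 * n + (k + 1) = 2 * n + k + 1 by ring,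
    div_mul_div_comm]
  simp only [qPoch_succ]
  congr 1 <;> ring

theorem wz_rational₁ {q x y : ℝ} (hA : 1 + q * x ≠ 0)
    (hC : 1 - q ^ 4 * x ^ 2 ≠ 0) (hD : 1 - q ^ 2 * x * y ≠ 0) :
    (1 - x ^ 2) * (1 - q * x * y ^ 2)
      - -(q * x * y ^ 2 * (1 - q * x) ^ 6)
        / ((1 - q ^ 2 * x * y) ^ 4 * (1 - q ^ 2 * x ^ 2) * (1 - q ^ 4 * x ^ 2))
        * ((1 - (q ^ 2 * x) ^ 2) * (1 - q * (q ^ 2 * x) * y ^ 2))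
    = cert₁ q x y / (1 + q * x)
      - x ^ 2 * (1 - q * y) ^ 4 / (1 - q ^ 2 * x * y) ^ 4
        * (cert₁ q x (q ^ 2 * y) / (1 + q * x)) := by
  have key := cert₁_wz q x y
  rw [show 1 - q ^ 2 * x ^ 2 = (1 - q * x) * (1 + q * x) by ring,
    show 1 - (q ^ 2 * x) ^ 2 = 1 - q ^ 4 * x ^ 2 by ring,
    show 1 - q * (q ^ 2 * x) * y ^ 2 = 1 - q ^ 3 * x * y ^ 2 by ring]
  -- Once `key` is available, the inner structure of the factors is irrelevant; treating them as
  -- atoms keeps the clearing of denominators from expanding the certificates.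
  generalize cert₁ q x y = c at *
  generalize cert₁ q x (q ^ 2 * y) = c' at *
  generalize 1 - q ^ 2 * x * y = d at *
  generalize 1 - q ^ 4 * x ^ 2 = e at *
  generalize 1 - q ^ 3 * x * y ^ 2 = f at *
  generalize 1 - q * x = g at *
  generalize 1 + q * x = a at *
  field_simp
  linear_combination key

theorem wz_rational₂ {q x y : ℝ} (hA : 1 + q * x ≠ 0)
    (hC : 1 - q ^ 4 * x ^ 2 ≠ 0) (hD : 1 - q ^ 2 * x ^ 2 * y ≠ 0)
    (hE : 1 - q ^ 4 * x ^ 2 * y ≠ 0) :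
    (1 - x ^ 2) * (1 - q * x ^ 3 * y ^ 2)
      - -(q ^ 5 * x ^ 5 * y ^ 2 * (1 - q * x) ^ 6 * (1 - q * x * y) ^ 4)
        / ((1 - q ^ 2 * x ^ 2 * y) ^ 4 * (1 - q ^ 4 * x ^ 2 * y) ^ 4 * (1 - q ^ 2 * x ^ 2)
          * (1 - q ^ 4 * x ^ 2))
        * ((1 - (q ^ 2 * x) ^ 2) * (1 - q * (q ^ 2 * x) ^ 3 * y ^ 2))
    = cert₂ q x y / ((1 + q * x) * (1 - q ^ 2 * x ^ 2 * y) ^ 4)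
      - x ^ 2 * (1 - q * x * y) ^ 4 / (1 - q ^ 2 * x ^ 2 * y) ^ 4
        * (cert₂ q x (q ^ 2 * y) / ((1 + q * x) * (1 - q ^ 2 * x ^ 2 * (q ^ 2 * y)) ^ 4)) := by
  have key := cert₂_wz q x y
  rw [show 1 - q ^ 2 * x ^ 2 = (1 - q * x) * (1 + q * x) by ring,
    show 1 - (q ^ 2 * x) ^ 2 = 1 - q ^ 4 * x ^ 2 by ring,
    show 1 - q * (q ^ 2 * x) ^ 3 * y ^ 2 = 1 - q ^ 7 * x ^ 3 * y ^ 2 by ring,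
    show 1 - q ^ 2 * x ^ 2 * (q ^ 2 * y) = 1 - q ^ 4 * x ^ 2 * y by ring]
  generalize cert₂ q x y = c at *
  generalize cert₂ q x (q ^ 2 * y) = c' at *
  generalize 1 - q ^ 2 * x ^ 2 * y = d at *
  generalize 1 - q ^ 4 * x ^ 2 * y = h at *
  generalize 1 - q ^ 4 * x ^ 2 = e at *
  generalize 1 - q ^ 7 * x ^ 3 * y ^ 2 = f at *
  generalize 1 - q * x * y = k at *
  generalize 1 - q * x = g at *
  generalize 1 + q * x = a at *
  field_simp
  linear_combination key

theorem wz_rational₃ {q x y : ℝ} (hA : 1 + q * x ≠ 0)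
    (hC : 1 - q ^ 4 * x ^ 2 ≠ 0) (hD : 1 - q ^ 2 * x ^ 2 * y ≠ 0)
    (hE : 1 - q ^ 4 * x ^ 2 * y ≠ 0) (hF : 1 - q ^ 2 * x * y ≠ 0) :
    (1 - x ^ 2) * (1 - q * x ^ 2 * y ^ 2)
      - q ^ 2 * x ^ 2 * y ^ 2 * (1 - q * x) ^ 4 * (1 - q * x ^ 2) * (1 - q ^ 3 * x ^ 2)
          * (1 - q * x * y) ^ 2
        / ((1 - q ^ 2 * x * y) ^ 2 * (1 - q ^ 2 * x ^ 2 * y) ^ 2 * (1 - q ^ 4 * x ^ 2 * y) ^ 2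
          * (1 - q ^ 2 * x ^ 2) * (1 - q ^ 4 * x ^ 2))
        * ((1 - (q ^ 2 * x) ^ 2) * (1 - q * (q ^ 2 * x) ^ 2 * y ^ 2))
    = cert₃ q x y / ((1 + q * x) * (1 - q ^ 2 * x ^ 2 * y) ^ 2)
      - x ^ 2 * (1 - q * x * y) ^ 2 * (1 - q * y) ^ 2
          / ((1 - q ^ 2 * x * y) ^ 2 * (1 - q ^ 2 * x ^ 2 * y) ^ 2)
        * (cert₃ q x (q ^ 2 * y) / ((1 + q * x) * (1 - q ^ 2 * x ^ 2 * (q ^ 2 * y)) ^ 2)) := by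
  have key := cert₃_wz q x y
  rw [show 1 - q ^ 2 * x ^ 2 = (1 - q * x) * (1 + q * x) by ring,
    show 1 - (q ^ 2 * x) ^ 2 = 1 - q ^ 4 * x ^ 2 by ring,
    show 1 - q * (q ^ 2 * x) ^ 2 * y ^ 2 = 1 - q ^ 5 * x ^ 2 * y ^ 2 by ring,
    show 1 - q ^ 2 * x ^ 2 * (q ^ 2 * y) = 1 - q ^ 4 * x ^ 2 * y by ring]
  generalize cert₃ q x y = c at *
  generalize cert₃ q x (q ^ 2 * y) = c' at *
  generalize 1 - q ^ 2 * x ^ 2 * y = d at *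
  generalize 1 - q ^ 4 * x ^ 2 * y = h at *
  generalize 1 - q ^ 4 * x ^ 2 = e at *
  generalize 1 - q ^ 5 * x ^ 2 * y ^ 2 = f at *
  generalize 1 - q ^ 2 * x * y = m at *
  generalize 1 - q * x * y = k at *
  generalize 1 - q * x = g at *
  generalize 1 - q * x ^ 2 = l at *
  generalize 1 - q ^ 3 * x ^ 2 = o at *
  generalize 1 + q * x = a at *
  field_simp
  linear_combination key

theorem one_sub_pos_of_lt {t s : ℝ} (ht0 : 0 ≤ t) (ht1 : t < 1) (hs : s ≤ 1) : 0 < 1 - t * s := by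
  nlinarith [mul_le_of_le_one_right ht0 hs]

theorem mul_mem_unit {a b : ℝ} (ha0 : 0 ≤ a) (ha1 : a ≤ 1) (hb0 : 0 ≤ b) (hb1 : b ≤ 1) :
    0 ≤ a * b ∧ a * b ≤ 1 :=
  ⟨mul_nonneg ha0 hb0, mul_le_one₀ ha1 hb0 hb1⟩

/-- The quotient is row `n = 0` of each of the three weights, so this limit is their common sum. -/
theorem tendsto_ratio {q : ℝ} (hq0 : 0 < q) (hq1 : q < 1) :
    Tendsto (fun k => (qPoch q (q ^ 2) k / qPoch (q ^ 2) (q ^ 2) k) ^ 4) atTop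
      (𝓝 ((1 - q ^ 2) ^ 2 / qGamma (q ^ 2) (1 / 2) ^ 4)) := by
  have hp0 : 0 ≤ q ^ 2 := sq_nonneg q
  have hp1 : q ^ 2 < 1 := by nlinarith
  rw [sq_div_qGamma_half_pow hq0 hq1]
  exact ((tendsto_qPoch hp0 hp1).div (tendsto_qPoch hp0 hp1)
    (qPochInf_pos hp0 hp1 hp0 hp1).ne').pow 4

theorem hasSum_S₁ {q : ℝ} (hq0 : 0 < q) (hq1 : q < 1) :
    HasSum (S₁ q) ((1 - q ^ 2) ^ 2 / qGamma (q ^ 2) (1 / 2) ^ 4) := by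
  have hp0 : 0 ≤ q ^ 2 := sq_nonneg q
  have hp1 : q ^ 2 < 1 := by nlinarith
  have hu := qPoch_pos hq0.le hq1 hp0 hp1
  have hu1 := qPoch_le_one hq0.le hq1 hp0 hp1
  have hδ := qPochInf_pos hp0 hp1 hp0 hp1
  have hv := qPochInf_le hp0 hp1 hp0 hp1
  have hx : ∀ n : ℕ, 0 ≤ q ^ (2 * n) ∧ q ^ (2 * n) ≤ 1 := fun n =>
    ⟨by positivity, pow_le_one₀ hq0.le hq1.le⟩
  have h := hasSum_of_wz_weight (W := W₁ q)
    (f := fun x y => (1 - x ^ 2) * (1 - q * x * y ^ 2)) (g := fun x y => cert₁ q x y / (1 + q * x))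
    (C := (1 - q ^ 2) ^ 2 / qGamma (q ^ 2) (1 / 2) ^ 4)
    (D := (qPochInf (q ^ 2) (q ^ 2) ^ 5)⁻¹) hq0 hq1 (fun n k => ?_) (fun n k hn => ?_) ?_ ?_ ?_ ?_ ?_
  · convert! h using 2 with n
    rw [W₁, S₁, cert₁, qPoch_zero, add_zero, mul_zero, add_zero]
    rw [div_mul_div_comm]
    congr 1 <;> ring
  · obtain ⟨hx0, hx1⟩ := hx n
    obtain ⟨hy0, hy1⟩ := hx k
    rw [W₁_succ_left, W₁_succ_right, mul_assoc (W₁ q n k), mul_assoc (W₁ q n k), ← mul_sub, ← mul_sub]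
    congr 1
    rw [show q ^ (2 * (n + 1)) = q ^ 2 * q ^ (2 * n) by ring,
      show q ^ (2 * (k + 1)) = q ^ 2 * q ^ (2 * k) by ring]
    refine wz_rational₁ (by positivity) ?_ ?_
    · exact (one_sub_pos_of_lt (by positivity) (pow_lt_one₀ hq0.le hq1 (by simp))
        (pow_le_one₀ hx0 hx1)).ne'
    · rw [mul_assoc]
      exact (one_sub_pos_of_lt hp0 hp1 (mul_mem_unit hx0 hx1 hy0 hy1).2).ne'
  · rw [mul_assoc]
    refine (abs_le_of_eq_mul_div (m := 5) ?_ ?_ ?_ hδ ?_ ?_ rfl).trans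
      (mul_le_mul_of_nonneg_left (pow_le_pow_mul_pow hq0 hq1 ?_) (by positivity))
    · positivity
    · exact mul_nonneg (pow_nonneg (hu _).le _) (pow_nonneg (hu _).le _)
    · exact mul_le_one₀ (pow_le_one₀ (hu _).le (hu1 _)) (pow_nonneg (hu _).le _)
        (pow_le_one₀ (hu _).le (hu1 _))
    -- The denominator has five factors with multiplicity, `4 + 1`, each at least `(q²;q²)_∞`; this
    -- is the exponent `5` in `D`.
    · rw [pow_succ]
      gcongr <;> exact hv _
    · simp
    · nlinarith [Nat.le_mul_of_pos_left k hn]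
  · convert! tendsto_ratio hq0 hq1 using 2 with k
    rw [W₁]
    simp [qPoch_zero, div_pow]
  · fun_prop
  · refine ContinuousOn.div (by unfold cert₁; fun_prop) (by fun_prop) fun z hz => ?_
    have := hz.1.1
    positivity
  · simp
  · have : 1 + q ≠ 0 := by positivity
    simp [cert₁, this]

theorem hasSum_S₂ {q : ℝ} (hq0 : 0 < q) (hq1 : q < 1) :
    HasSum (S₂ q) ((1 - q ^ 2) ^ 2 / qGamma (q ^ 2) (1 / 2) ^ 4) := by
  have hp0 : 0 ≤ q ^ 2 := sq_nonneg q
  have hp1 : q ^ 2 < 1 := by nlinarith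
  have hu := qPoch_pos hq0.le hq1 hp0 hp1
  have hu1 := qPoch_le_one hq0.le hq1 hp0 hp1
  have hδ := qPochInf_pos hp0 hp1 hp0 hp1
  have hv := qPochInf_le hp0 hp1 hp0 hp1
  have hx : ∀ n : ℕ, 0 ≤ q ^ (2 * n) ∧ q ^ (2 * n) ≤ 1 := fun n =>
    ⟨by positivity, pow_le_one₀ hq0.le hq1.le⟩
  have h := hasSum_of_wz_weight (W := W₂ q)
    (f := fun x y => (1 - x ^ 2) * (1 - q * x ^ 3 * y ^ 2))
    (g := fun x y => cert₂ q x y / ((1 + q * x) * (1 - q ^ 2 * x ^ 2 * y) ^ 4))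
    (C := (1 - q ^ 2) ^ 2 / qGamma (q ^ 2) (1 / 2) ^ 4)
    (D := (qPochInf (q ^ 2) (q ^ 2) ^ 5)⁻¹) hq0 hq1 (fun n k => ?_) (fun n k hn => ?_) ?_ ?_ ?_ ?_ ?_
  · convert! h using 2 with n
    have hb := (one_sub_pos_of_lt hq0.le hq1 (hx n).2).ne'
    rw [W₂, S₂, cert₂_one, add_zero, mul_zero, add_zero, add_zero,
      show (1 + q * q ^ (2 * n)) * (1 - q ^ 2 * (q ^ (2 * n)) ^ 2 * 1) ^ 4
        = (q ^ (2 * n + 1) + 1) ^ 5 * (1 - q * q ^ (2 * n)) ^ 4 by ring,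
      mul_div_mul_right _ _ (pow_ne_zero 4 hb), div_mul_div_comm]
    congr 1 <;> ring
  · obtain ⟨hx0, hx1⟩ := hx n
    obtain ⟨hy0, hy1⟩ := hx k
    have hxx := pow_le_one₀ (n := 2) hx0 hx1
    have h4 := pow_lt_one₀ hq0.le hq1 (by simp : 4 ≠ 0)
    rw [W₂_succ_left, W₂_succ_right, mul_assoc (W₂ q n k), mul_assoc (W₂ q n k), ← mul_sub, ← mul_sub]
    congr 1
    rw [show q ^ (2 * (n + 1)) = q ^ 2 * q ^ (2 * n) by ring,
      show q ^ (2 * (k + 1)) = q ^ 2 * q ^ (2 * k) by ring]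
    refine wz_rational₂ (by positivity) ?_ ?_ ?_
    · exact (one_sub_pos_of_lt (by positivity) h4 hxx).ne'
    · rw [mul_assoc]
      exact (one_sub_pos_of_lt hp0 hp1 (mul_mem_unit (sq_nonneg _) hxx hy0 hy1).2).ne'
    · rw [mul_assoc]
      exact (one_sub_pos_of_lt (by positivity) h4 (mul_mem_unit (sq_nonneg _) hxx hy0 hy1).2).ne'
  · rw [mul_assoc]
    refine (abs_le_of_eq_mul_div (m := 5) ?_ ?_ ?_ hδ ?_ ?_ rfl).trans
      (mul_le_mul_of_nonneg_left (pow_le_pow_mul_pow hq0 hq1 ?_) (by positivity))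
    · positivity
    · exact mul_nonneg (pow_nonneg (hu _).le _) (pow_nonneg (hu _).le _)
    · exact mul_le_one₀ (pow_le_one₀ (hu _).le (hu1 _)) (pow_nonneg (hu _).le _)
        (pow_le_one₀ (hu _).le (hu1 _))
    · rw [pow_succ]
      gcongr <;> exact hv _
    · simp
    · nlinarith [Nat.le_mul_of_pos_left k hn]
  · convert! tendsto_ratio hq0 hq1 using 2 with k
    rw [W₂]
    simp [qPoch_zero, div_pow]
  · fun_prop
  · refine ContinuousOn.div (by unfold cert₂; fun_prop) (by fun_prop) fun z hz => ?_
    have hz1 := hz.1.1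
    have : 1 - q ^ 2 * z.1 ^ 2 * z.2 ≠ 0 := by
      rw [mul_assoc]
      exact (one_sub_pos_of_lt hp0 hp1
        (mul_mem_unit (sq_nonneg _) (pow_le_one₀ hz1 hz.1.2) hz.2.1 hz.2.2).2).ne'
    have h2 : 1 + q * z.1 ≠ 0 := by positivity
    exact mul_ne_zero h2 (pow_ne_zero 4 this)
  · simp
  · have : 1 + q ≠ 0 := by positivity
    simp [cert₂, this]

theorem hasSum_S₃ {q : ℝ} (hq0 : 0 < q) (hq1 : q < 1) :
    HasSum (S₃ q) ((1 - q ^ 2) ^ 2 / qGamma (q ^ 2) (1 / 2) ^ 4) := by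
  have hp0 : 0 ≤ q ^ 2 := sq_nonneg q
  have hp1 : q ^ 2 < 1 := by nlinarith
  have hu := qPoch_pos hq0.le hq1 hp0 hp1
  have hu1 := qPoch_le_one hq0.le hq1 hp0 hp1
  have hδ := qPochInf_pos hp0 hp1 hp0 hp1
  have hv := qPochInf_le hp0 hp1 hp0 hp1
  have hx : ∀ n : ℕ, 0 ≤ q ^ (2 * n) ∧ q ^ (2 * n) ≤ 1 := fun n =>
    ⟨by positivity, pow_le_one₀ hq0.le hq1.le⟩
  have h := hasSum_of_wz_weight (W := W₃ q)
    (f := fun x y => (1 - x ^ 2) * (1 - q * x ^ 2 * y ^ 2))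
    (g := fun x y => cert₃ q x y / ((1 + q * x) * (1 - q ^ 2 * x ^ 2 * y) ^ 2))
    (C := (1 - q ^ 2) ^ 2 / qGamma (q ^ 2) (1 / 2) ^ 4)
    (D := (qPochInf (q ^ 2) (q ^ 2) ^ 5)⁻¹) hq0 hq1 (fun n k => ?_) (fun n k hn => ?_) ?_ ?_ ?_ ?_ ?_
  · convert! h using 2 with n
    have hb := (one_sub_pos_of_lt hq0.le hq1 (hx n).2).ne'
    rw [W₃, S₃, cert₃_one, qPoch_zero, add_zero, mul_zero, add_zero, add_zero,
      show (1 + q * q ^ (2 * n)) * (1 - q ^ 2 * (q ^ (2 * n)) ^ 2 * 1) ^ 2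
        = (q ^ (2 * n + 1) + 1) ^ 3 * (1 - q * q ^ (2 * n)) ^ 2 by ring,
      mul_div_mul_right _ _ (pow_ne_zero 2 hb), div_mul_div_comm]
    congr 1 <;> ring
  · obtain ⟨hx0, hx1⟩ := hx n
    obtain ⟨hy0, hy1⟩ := hx k
    have hxx := pow_le_one₀ (n := 2) hx0 hx1
    have h4 := pow_lt_one₀ hq0.le hq1 (by simp : 4 ≠ 0)
    rw [W₃_succ_left, W₃_succ_right, mul_assoc (W₃ q n k), mul_assoc (W₃ q n k), ← mul_sub, ← mul_sub]
    congr 1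
    rw [show q ^ (2 * (n + 1)) = q ^ 2 * q ^ (2 * n) by ring,
      show q ^ (2 * (k + 1)) = q ^ 2 * q ^ (2 * k) by ring]
    refine wz_rational₃ (by positivity) ?_ ?_ ?_ ?_
    · exact (one_sub_pos_of_lt (by positivity) h4 hxx).ne'
    · rw [mul_assoc]
      exact (one_sub_pos_of_lt hp0 hp1 (mul_mem_unit (sq_nonneg _) hxx hy0 hy1).2).ne'
    · rw [mul_assoc]
      exact (one_sub_pos_of_lt (by positivity) h4 (mul_mem_unit (sq_nonneg _) hxx hy0 hy1).2).ne'
    · rw [mul_assoc]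
      exact (one_sub_pos_of_lt hp0 hp1 (mul_mem_unit hx0 hx1 hy0 hy1).2).ne'
  · have hpow : ∀ m i, 0 ≤ qPoch q (q ^ 2) m ^ i ∧ qPoch q (q ^ 2) m ^ i ≤ 1 := fun m i =>
      ⟨pow_nonneg (hu m).le i, pow_le_one₀ (hu m).le (hu1 m)⟩
    have hP := mul_mem_unit (hpow n 4).1 (hpow n 4).2 (hu (2 * n)).le (hu1 (2 * n))
    have hP := mul_mem_unit hP.1 hP.2 (hpow (n + k) 2).1 (hpow (n + k) 2).2
    have hP := mul_mem_unit hP.1 hP.2 (hpow k 2).1 (hpow k 2).2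
    rw [mul_assoc]
    -- The leading factor `1` of `W₃` fills the place of the sign `s`, so that the shape matches by
    -- `rfl`.
    refine (abs_le_of_eq_mul_div (m := 5) ?_ hP.1 hP.2 hδ ?_ ?_ rfl).trans
      (mul_le_mul_of_nonneg_left (pow_le_pow_mul_pow hq0 hq1 ?_) (by positivity))
    · positivity
    · rw [pow_succ, show 4 = 2 + 2 from rfl, pow_add]
      gcongr <;> exact hv _
    · simp
    · nlinarith [Nat.le_mul_of_pos_left k hn]
  · convert! tendsto_ratio hq0 hq1 using 2 with k
    rw [W₃]
    simp [qPoch_zero, div_pow, ← pow_add]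
  · fun_prop
  · refine ContinuousOn.div (by unfold cert₃; fun_prop) (by fun_prop) fun z hz => ?_
    have hz1 := hz.1.1
    have : 1 - q ^ 2 * z.1 ^ 2 * z.2 ≠ 0 := by
      rw [mul_assoc]
      exact (one_sub_pos_of_lt hp0 hp1
        (mul_mem_unit (sq_nonneg _) (pow_le_one₀ hz1 hz.1.2) hz.2.1 hz.2.2).2).ne'
    have h2 : 1 + q * z.1 ≠ 0 := by positivity
    exact mul_ne_zero h2 (pow_ne_zero 2 this)
  · simp
  · have : 1 + q ≠ 0 := by positivity
    simp [cert₃, this]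

/-! ### Termwise limits -/

/-- The quotient of `q ^ e - 1 - e (q - 1)` by `(q - 1) ^ 2`. -/
def taylorQuot (e : ℕ) (q : ℝ) : ℝ := ∑ j ∈ Finset.range e, ∑ i ∈ Finset.range j, q ^ i

/-- An exact second-order expansion with polynomial remainder: a combination of powers with
vanishing constant and linear parts becomes `(1 - q) ^ 2` times a function continuous at `1`. -/
theorem pow_eq_taylorQuot (e : ℕ) (q : ℝ) :
    q ^ e = 1 + e * (q - 1) + (q - 1) ^ 2 * taylorQuot e q := by
  have h : ∀ j : ℕ, (∑ i ∈ Finset.range j, q ^ i) * (q - 1) = q ^ j - 1 := fun j => geom_sum_mul q j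
  induction e with
  | zero => simp [taylorQuot]
  | succ e ih =>
    have h1 : taylorQuot (e + 1) q = taylorQuot e q + ∑ i ∈ Finset.range e, q ^ i :=
      Finset.sum_range_succ _ _
    rw [h1, pow_succ]
    push_cast
    linear_combination ih - (q - 1) * h e

theorem continuous_taylorQuot (e : ℕ) : Continuous (taylorQuot e) := by
  unfold taylorQuot
  fun_prop

theorem taylorQuot_one (e : ℕ) : taylorQuot e 1 = e * (e - 1) / 2 := by
  induction e with
  | zero => simp [taylorQuot]
  | succ e ih =>
    have h1 : taylorQuot (e + 1) 1 = taylorQuot e 1 + ∑ i ∈ Finset.range e, (1 : ℝ) ^ i :=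
      Finset.sum_range_succ _ _
    rw [h1, ih]
    push_cast
    simp
    ring

/-- The quotient of `(q; q²)_n` by `(1 - q) ^ n`. -/
def oddProd (n : ℕ) (q : ℝ) : ℝ := ∏ k ∈ Finset.range n, ∑ i ∈ Finset.range (2 * k + 1), q ^ i

/-- The quotient of `(q²; q²)_n` by `(1 - q) ^ n`. -/
def evenProd (n : ℕ) (q : ℝ) : ℝ := ∏ k ∈ Finset.range n, ∑ i ∈ Finset.range (2 * k + 2), q ^ i

theorem continuous_oddProd (n : ℕ) : Continuous (oddProd n) := by
  unfold oddProd
  fun_prop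

theorem continuous_evenProd (n : ℕ) : Continuous (evenProd n) := by
  unfold evenProd
  fun_prop

theorem qPoch_eq_oddProd (q : ℝ) (n : ℕ) : qPoch q (q ^ 2) n = (1 - q) ^ n * oddProd n q := by
  rw [qPoch, oddProd, ← Finset.card_range n, ← Finset.prod_const, Finset.card_range,
    ← Finset.prod_mul_distrib]
  refine Finset.prod_congr rfl fun k _ => ?_
  rw [mul_neg_geom_sum]
  ring

theorem qPoch_eq_evenProd (q : ℝ) (n : ℕ) :
    qPoch (q ^ 2) (q ^ 2) n = (1 - q) ^ n * evenProd n q := by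
  rw [qPoch, evenProd, ← Finset.card_range n, ← Finset.prod_const, Finset.card_range,
    ← Finset.prod_mul_distrib]
  refine Finset.prod_congr rfl fun k _ => ?_
  rw [mul_neg_geom_sum]
  ring

theorem oddProd_succ_one (n : ℕ) : oddProd (n + 1) 1 = oddProd n 1 * (2 * n + 1) := by
  rw [oddProd, Finset.prod_range_succ, ← oddProd]
  simp

theorem evenProd_succ_one (n : ℕ) : evenProd (n + 1) 1 = evenProd n 1 * (2 * n + 2) := by
  rw [evenProd, Finset.prod_range_succ, ← evenProd]
  simp

theorem poch_succ (a : ℝ) (n : ℕ) : poch a (n + 1) = poch a n * (a + n) :=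
  ascPochhammer_succ_eval n a

theorem poch_zero (a : ℝ) : poch a 0 = 1 := by simp [poch]

theorem poch_pos {a : ℝ} (ha : 0 < a) (n : ℕ) : 0 < poch a n := ascPochhammer_pos n a ha

theorem oddProd_one (n : ℕ) : oddProd n 1 = 2 ^ n * poch (1 / 2) n := by
  induction n with
  | zero => simp [oddProd, poch_zero]
  | succ n ih =>
    rw [oddProd_succ_one, ih, poch_succ]
    ring

theorem evenProd_one (n : ℕ) : evenProd n 1 = 2 ^ n * poch 1 n := by
  induction n with
  | zero => simp [evenProd, poch_zero]
  | succ n ih =>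
    rw [evenProd_succ_one, ih, poch_succ]
    ring

/-- The odd numbers split into `4 * n + 1 = 4 * (1 / 4 + n)` and `4 * n + 3 = 4 * (3 / 4 + n)`, the
source of `(1/4)_n (3/4)_n` in the third classical series. -/
theorem oddProd_two_mul_one (n : ℕ) :
    oddProd (2 * n) 1 = 2 ^ (4 * n) * (poch (1 / 4) n * poch (3 / 4) n) := by
  induction n with
  | zero => simp [oddProd, poch_zero]
  | succ n ih =>
    rw [show 2 * (n + 1) = 2 * n + 1 + 1 by ring, oddProd_succ_one, oddProd_succ_one, ih, poch_succ,
      poch_succ]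
    push_cast
    ring

theorem evenProd_two_mul_one (n : ℕ) :
    evenProd (2 * n) 1 = 2 ^ (4 * n) * (poch (1 / 2) n * poch 1 n) := by
  induction n with
  | zero => simp [evenProd, poch_zero]
  | succ n ih =>
    rw [show 2 * (n + 1) = 2 * n + 1 + 1 by ring, evenProd_succ_one, evenProd_succ_one, ih,
      poch_succ, poch_succ]
    push_cast
    ring

theorem evenProd_one_pos (n : ℕ) : 0 < evenProd n 1 := by
  have := poch_pos one_pos n
  rw [evenProd_one]
  positivity

/-- The quotient of the polynomial factor of `S₁` by `(1 - q) ^ 2`. -/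
def polyQuot₁ (n : ℕ) (q : ℝ) : ℝ :=
  taylorQuot (2 * n + 1) q - 4 * taylorQuot (4 * n + 1) q + taylorQuot (6 * n + 1) q
    + taylorQuot (8 * n + 2) q

/-- The quotient of `P₁` by `(1 - q) ^ 2`. -/
def polyQuot₂ (n : ℕ) (q : ℝ) : ℝ :=
  5 * taylorQuot (2 * n + 1) q + 10 * taylorQuot (4 * n + 2) q - 5 * taylorQuot (6 * n + 1) q
    + 10 * taylorQuot (6 * n + 3) q - 15 * taylorQuot (8 * n + 2) q + 5 * taylorQuot (8 * n + 4) q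
    + taylorQuot (10 * n + 1) q - 24 * taylorQuot (10 * n + 3) q + taylorQuot (10 * n + 5) q
    + 5 * taylorQuot (12 * n + 2) q - 15 * taylorQuot (12 * n + 4) q
    + 10 * taylorQuot (14 * n + 3) q - 5 * taylorQuot (14 * n + 5) q
    + 10 * taylorQuot (16 * n + 4) q + 5 * taylorQuot (18 * n + 5) q + taylorQuot (20 * n + 6) q

/-- The quotient of `P₂` by `(1 - q) ^ 2`. -/
def polyQuot₃ (n : ℕ) (q : ℝ) : ℝ :=
  3 * taylorQuot (2 * n + 1) q - 3 * taylorQuot (4 * n + 1) q + 3 * taylorQuot (4 * n + 2) q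
    - 2 * taylorQuot (6 * n + 1) q - 3 * taylorQuot (6 * n + 2) q + taylorQuot (6 * n + 3) q
    + taylorQuot (8 * n + 1) q - 3 * taylorQuot (8 * n + 2) q - 2 * taylorQuot (8 * n + 3) q
    + 3 * taylorQuot (10 * n + 2) q - 3 * taylorQuot (10 * n + 3) q + 3 * taylorQuot (12 * n + 3) q
    + taylorQuot (14 * n + 4) q

/-- The coefficients sum to zero, and so do the coefficients weighted by their exponents; only the
second-order remainders are left. -/
theorem poly₁_eq (q : ℝ) (n : ℕ) :
    q ^ (2 * n + 1) - 4 * q ^ (4 * n + 1) + q ^ (6 * n + 1) + q ^ (8 * n + 2) + 1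
      = (1 - q) ^ 2 * polyQuot₁ n q := by
  unfold polyQuot₁
  rw [pow_eq_taylorQuot (2 * n + 1), pow_eq_taylorQuot (4 * n + 1), pow_eq_taylorQuot (6 * n + 1),
    pow_eq_taylorQuot (8 * n + 2)]
  push_cast
  ring

theorem P₁_eq (q : ℝ) (n : ℕ) : P₁ q n = (1 - q) ^ 2 * polyQuot₂ n q := by
  unfold P₁ polyQuot₂
  rw [pow_eq_taylorQuot (2 * n + 1), pow_eq_taylorQuot (4 * n + 2), pow_eq_taylorQuot (6 * n + 1),
    pow_eq_taylorQuot (6 * n + 3), pow_eq_taylorQuot (8 * n + 2), pow_eq_taylorQuot (8 * n + 4),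
    pow_eq_taylorQuot (10 * n + 1), pow_eq_taylorQuot (10 * n + 3), pow_eq_taylorQuot (10 * n + 5),
    pow_eq_taylorQuot (12 * n + 2), pow_eq_taylorQuot (12 * n + 4), pow_eq_taylorQuot (14 * n + 3),
    pow_eq_taylorQuot (14 * n + 5), pow_eq_taylorQuot (16 * n + 4), pow_eq_taylorQuot (18 * n + 5),
    pow_eq_taylorQuot (20 * n + 6)]
  push_cast
  ring

theorem P₂_eq (q : ℝ) (n : ℕ) : P₂ q n = (1 - q) ^ 2 * polyQuot₃ n q := by
  unfold P₂ polyQuot₃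
  rw [pow_eq_taylorQuot (2 * n + 1), pow_eq_taylorQuot (4 * n + 1), pow_eq_taylorQuot (4 * n + 2),
    pow_eq_taylorQuot (6 * n + 1), pow_eq_taylorQuot (6 * n + 2), pow_eq_taylorQuot (6 * n + 3),
    pow_eq_taylorQuot (8 * n + 1), pow_eq_taylorQuot (8 * n + 2), pow_eq_taylorQuot (8 * n + 3),
    pow_eq_taylorQuot (10 * n + 2), pow_eq_taylorQuot (10 * n + 3), pow_eq_taylorQuot (12 * n + 3),
    pow_eq_taylorQuot (14 * n + 4)]
  push_cast
  ring

/-- A function agreeing to the left of `1` with a function continuous at `1` tends to the value of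
the latter. -/
theorem tendsto_left_one_of_eq {f g : ℝ → ℝ} {l : ℝ} (h : ∀ q, 0 < q → q < 1 → f q = g q)
    (hg : ContinuousAt g 1) (hl : g 1 = l) : Tendsto f (𝓝[<] 1) (𝓝 l) := by
  rw [← hl]
  refine (hg.tendsto.mono_left nhdsWithin_le_nhds).congr' ?_
  filter_upwards [Ioo_mem_nhdsLT (zero_lt_one' ℝ)] with q hq
  exact (h q hq.1 hq.2).symm

theorem tendsto_S₁ (n : ℕ) :
    Tendsto (fun q : ℝ => 8 * (S₁ q n / (1 - q ^ 2) ^ 2)) (𝓝[<] 1) (𝓝 (R₁ n)) := by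
  have he := (evenProd_one_pos n).ne'
  have he2 := (evenProd_one_pos (2 * n)).ne'
  refine tendsto_left_one_of_eq (g := fun q => 8 * ((-1) ^ n * q ^ (n ^ 2) * polyQuot₁ n q
      * oddProd n q ^ 6 / ((q ^ (2 * n + 1) + 1) * evenProd (2 * n) q * evenProd n q ^ 4
        * (1 + q) ^ 2))) (fun q hq0 hq1 => ?_) ?_ ?_
  · have h1 : 1 - q ≠ 0 := by linarith
    rw [S₁, poly₁_eq, qPoch_eq_oddProd, qPoch_eq_evenProd, qPoch_eq_evenProd, div_div]
    congr 1
    -- The numerator contributes `6 * n` powers of `1 - q` from the shifted factorials and `2` from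
    -- the polynomial; the denominator contributes `2 * n + 4 * n`, and `2` from `(1 - q ^ 2) ^ 2`.
    refine Eq.trans ?_ (mul_div_mul_right _ _ (pow_ne_zero (6 * n + 2) h1))
    congr 1 <;> ring
  · have := continuous_oddProd n
    have := continuous_evenProd n
    have := continuous_evenProd (2 * n)
    have : Continuous (polyQuot₁ n) := by
      have := continuous_taylorQuot
      unfold polyQuot₁
      fun_prop
    refine ContinuousAt.mul continuousAt_const (ContinuousAt.div (by fun_prop) (by fun_prop) ?_)
    simp [he, he2]
  · have hh := (poch_pos (by norm_num : (0 : ℝ) < 1 / 2) n).ne'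
    have h1 := (poch_pos one_pos n).ne'
    -- This must precede `evenProd_one`, which would also rewrite the factor at index `2 * n`.
    simp only [evenProd_two_mul_one]
    simp only [polyQuot₁, taylorQuot_one, oddProd_one, evenProd_one, R₁, one_pow]
    push_cast
    field_simp
    ring

theorem tendsto_S₂ (n : ℕ) :
    Tendsto (fun q : ℝ => 128 * (S₂ q n / (1 - q ^ 2) ^ 2)) (𝓝[<] 1) (𝓝 (R₂ n)) := by
  have he2 := (evenProd_one_pos (2 * n)).ne'
  refine tendsto_left_one_of_eq (g := fun q => 128 * ((-1) ^ n * q ^ (5 * n ^ 2) * polyQuot₂ n q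
      * oddProd n q ^ 10 / ((q ^ (2 * n + 1) + 1) ^ 5 * evenProd (2 * n) q ^ 5
        * (1 + q) ^ 2))) (fun q hq0 hq1 => ?_) ?_ ?_
  · have h1 : 1 - q ≠ 0 := by linarith
    rw [S₂, P₁_eq, qPoch_eq_oddProd, qPoch_eq_evenProd, div_div]
    congr 1
    refine Eq.trans ?_ (mul_div_mul_right _ _ (pow_ne_zero (10 * n + 2) h1))
    congr 1 <;> ring
  · have := continuous_oddProd n
    have := continuous_evenProd (2 * n)
    have : Continuous (polyQuot₂ n) := by
      have := continuous_taylorQuot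
      unfold polyQuot₂
      fun_prop
    refine ContinuousAt.mul continuousAt_const (ContinuousAt.div (by fun_prop) (by fun_prop) ?_)
    simp [he2]
  · have hh := (poch_pos (by norm_num : (0 : ℝ) < 1 / 2) n).ne'
    have h1 := (poch_pos one_pos n).ne'
    simp only [polyQuot₂, taylorQuot_one, oddProd_one, evenProd_two_mul_one, R₂, one_pow]
    push_cast
    field_simp
    ring

theorem tendsto_S₃ (n : ℕ) :
    Tendsto (fun q : ℝ => 32 * (S₃ q n / (1 - q ^ 2) ^ 2)) (𝓝[<] 1) (𝓝 (R₃ n)) := by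
  have he := (evenProd_one_pos n).ne'
  have he2 := (evenProd_one_pos (2 * n)).ne'
  refine tendsto_left_one_of_eq (g := fun q => 32 * (q ^ (2 * n ^ 2) * polyQuot₃ n q
      * oddProd (2 * n) q * oddProd n q ^ 6 / ((q ^ (2 * n + 1) + 1) ^ 3 * evenProd n q ^ 2
        * evenProd (2 * n) q ^ 3 * (1 + q) ^ 2))) (fun q hq0 hq1 => ?_) ?_ ?_
  · have h1 : 1 - q ≠ 0 := by linarith
    rw [S₃, P₂_eq, qPoch_eq_oddProd, qPoch_eq_oddProd, qPoch_eq_evenProd, qPoch_eq_evenProd,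
      div_div]
    congr 1
    refine Eq.trans ?_ (mul_div_mul_right _ _ (pow_ne_zero (8 * n + 2) h1))
    congr 1 <;> ring
  · have := continuous_oddProd n
    have := continuous_oddProd (2 * n)
    have := continuous_evenProd n
    have := continuous_evenProd (2 * n)
    have : Continuous (polyQuot₃ n) := by
      have := continuous_taylorQuot
      unfold polyQuot₃
      fun_prop
    refine ContinuousAt.mul continuousAt_const (ContinuousAt.div (by fun_prop) (by fun_prop) ?_)
    simp [he, he2]
  · have hh := (poch_pos (by norm_num : (0 : ℝ) < 1 / 2) n).ne'
    have h1 := (poch_pos one_pos n).ne'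
    simp only [oddProd_two_mul_one, evenProd_two_mul_one]
    simp only [polyQuot₃, taylorQuot_one, oddProd_one, evenProd_one, R₃, one_pow, one_div_pow,
      ← pow_mul]
    push_cast
    field_simp
    ring

/-! ### The limit of the `q`-gamma function -/

/-- This is AM–GM for `1, q, …, q ^ (2 * m)`, whose geometric mean is `q ^ m`, multiplied by `1 -
q`. -/
theorem mul_pow_mul_le_one_sub_pow {q : ℝ} (hq0 : 0 ≤ q) (hq1 : q ≤ 1) (m : ℕ) :
    (2 * m + 1) * q ^ m * (1 - q) ≤ 1 - q ^ (2 * m + 1) := by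
  have bern : ∀ m : ℕ, 1 - q ^ m ≤ m * (1 - q) := fun m => by
    have := one_add_mul_le_pow (a := q - 1) (by linarith) m
    rw [add_sub_cancel] at this
    linarith
  induction m with
  | zero => simp
  | succ m ih =>
    have h1 := bern m
    have h2 := bern (m + 1)
    push_cast at h2 ⊢
    have hm : 0 ≤ (m : ℝ) := m.cast_nonneg
    have h3 : q * (1 - q ^ m) ≤ m * (1 - q) :=
      (mul_le_of_le_one_left (by linarith [pow_le_one₀ (n := m) hq0 hq1]) hq1).trans h1
    have h4 : q * (1 - q ^ (m + 1)) ≤ (m + 1) * (1 - q) :=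
      (mul_le_of_le_one_left (by linarith [pow_le_one₀ (n := m + 1) hq0 hq1]) hq1).trans h2
    -- This quantity is exactly the increment of the right side minus that of the left side when `m`
    -- becomes `m + 1`; Bernoulli's inequality, used twice, makes it nonnegative.
    have h5 : 0 ≤ q ^ m * (1 - q)
        * ((2 * m + 1) * (1 - q) - q * (1 - q ^ m) - q * (1 - q ^ (m + 1))) :=
      mul_nonneg (mul_nonneg (pow_nonneg hq0 m) (by linarith)) (by linarith)
    have e : q ^ (2 * (m + 1) + 1) = q ^ m * q ^ m * q ^ 3 := by ring
    have e' : q ^ (2 * m + 1) = q ^ m * q ^ m * q := by ring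
    rw [e]
    rw [e'] at ih
    rw [pow_succ] at h5 ⊢
    nlinarith

/-- The partial products of a `q`-analogue of Wallis' product. -/
def qWallis (q : ℝ) (N : ℕ) : ℝ :=
  ∏ m ∈ Finset.range N,
    (1 - q ^ (2 * m + 2)) ^ 2 / ((1 - q ^ (2 * m + 1)) * (1 - q ^ (2 * m + 3)))

theorem qWallis_eq {q : ℝ} (hq0 : 0 ≤ q) (hq1 : q < 1) (N : ℕ) :
    qWallis q N
      = (1 - q) * qPoch (q ^ 2) (q ^ 2) N ^ 2 / (qPoch q (q ^ 2) N * qPoch q (q ^ 2) (N + 1)) := by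
  have hp0 : 0 ≤ q ^ 2 := sq_nonneg q
  have hp1 : q ^ 2 < 1 := by nlinarith
  induction N with
  | zero =>
    have : 1 - q ≠ 0 := by linarith
    simp [qWallis, qPoch, this]
  | succ N ih =>
    have h0 := (qPoch_pos hq0 hq1 hp0 hp1 N).ne'
    have h1 := (one_sub_mul_pow_pos hq0 hq1 hp0 hp1 N).ne'
    have h2 := (one_sub_mul_pow_pos hq0 hq1 hp0 hp1 (N + 1)).ne'
    rw [qWallis, Finset.prod_range_succ, ← qWallis, ih]
    simp only [qPoch_succ]
    rw [show q ^ (2 * N + 1) = q * (q ^ 2) ^ N by ring,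
      show q ^ (2 * N + 3) = q * (q ^ 2) ^ (N + 1) by ring,
      show q ^ (2 * N + 2) = q ^ 2 * (q ^ 2) ^ N by ring]
    field_simp

theorem qWallis_factor_eq {q : ℝ} (hq0 : 0 ≤ q) (hq1 : q < 1) (m : ℕ) :
    (1 - q ^ (2 * m + 2)) ^ 2 / ((1 - q ^ (2 * m + 1)) * (1 - q ^ (2 * m + 3)))
      = 1 + q ^ (2 * m + 1) * (1 - q) ^ 2 / ((1 - q ^ (2 * m + 1)) * (1 - q ^ (2 * m + 3))) := by
  have h1 : 1 - q ^ (2 * m + 1) ≠ 0 := by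
    linarith [pow_lt_one₀ hq0 hq1 (by omega : 2 * m + 1 ≠ 0)]
  have h3 : 1 - q ^ (2 * m + 3) ≠ 0 := by
    linarith [pow_lt_one₀ hq0 hq1 (by omega : 2 * m + 3 ≠ 0)]
  rw [div_eq_iff (mul_ne_zero h1 h3), add_mul, div_mul_cancel₀ _ (mul_ne_zero h1 h3)]
  ring

theorem one_le_qWallis_factor {q : ℝ} (hq0 : 0 ≤ q) (hq1 : q < 1) (m : ℕ) :
    1 ≤ (1 - q ^ (2 * m + 2)) ^ 2 / ((1 - q ^ (2 * m + 1)) * (1 - q ^ (2 * m + 3))) := by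
  rw [qWallis_factor_eq hq0 hq1]
  have h1 := pow_le_one₀ (n := 2 * m + 1) hq0 hq1.le
  have h3 := pow_le_one₀ (n := 2 * m + 3) hq0 hq1.le
  have : 0 ≤ (1 - q ^ (2 * m + 1)) * (1 - q ^ (2 * m + 3)) :=
    mul_nonneg (by linarith) (by linarith)
  have : 0 ≤ q ^ (2 * m + 1) * (1 - q) ^ 2 / ((1 - q ^ (2 * m + 1)) * (1 - q ^ (2 * m + 3))) := by
    positivity
  linarith

theorem qWallis_factor_le {q : ℝ} (hq0 : 0 ≤ q) (hq1 : q < 1) (m : ℕ) :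
    (1 - q ^ (2 * m + 2)) ^ 2 / ((1 - q ^ (2 * m + 1)) * (1 - q ^ (2 * m + 3)))
      ≤ (2 * m + 2) / (2 * m + 1) * ((2 * m + 2) / (2 * m + 3)) := by
  have h1 : 0 < 1 - q ^ (2 * m + 1) := by
    linarith [pow_lt_one₀ hq0 hq1 (by omega : 2 * m + 1 ≠ 0)]
  have h3 : 0 < 1 - q ^ (2 * m + 3) := by
    linarith [pow_lt_one₀ hq0 hq1 (by omega : 2 * m + 3 ≠ 0)]
  have e : (2 * m + 2) / (2 * m + 1) * ((2 * m + 2) / (2 * m + 3))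
      = 1 + 1 / ((2 * m + 1) * (2 * m + 3) : ℝ) := by
    field_simp
    ring
  rw [qWallis_factor_eq hq0 hq1, e]
  refine add_le_add_right ?_ 1
  rw [div_le_div_iff₀ (mul_pos h1 h3) (by positivity), one_mul]
  -- The instances `m` and `m + 1` multiply to the required `q ^ m * q ^ (m + 1) = q ^ (2 * m + 1)`.
  have b1 := mul_pow_mul_le_one_sub_pow hq0 hq1.le m
  have b2 := mul_pow_mul_le_one_sub_pow hq0 hq1.le (m + 1)
  push_cast at b2
  have hq : 0 ≤ 1 - q := by linarith
  calc _ = (2 * m + 1) * q ^ m * (1 - q) * ((2 * (m + 1) + 1) * q ^ (m + 1) * (1 - q)) := by ring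
    _ ≤ (1 - q ^ (2 * m + 1)) * (1 - q ^ (2 * (m + 1) + 1)) :=
      mul_le_mul b1 b2 (by positivity) h1.le
    _ = _ := rfl

theorem qWallis_le {q : ℝ} (hq0 : 0 ≤ q) (hq1 : q < 1) (N : ℕ) : qWallis q N ≤ Real.pi / 2 :=
  (Finset.prod_le_prod (fun m _ => zero_le_one.trans (one_le_qWallis_factor hq0 hq1 m))
    fun m _ => qWallis_factor_le hq0 hq1 m).trans (Real.Wallis.W_le N)

theorem monotone_qWallis {q : ℝ} (hq0 : 0 ≤ q) (hq1 : q < 1) : Monotone (qWallis q) := by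
  refine monotone_nat_of_le_succ fun N => ?_
  conv_rhs => rw [qWallis, Finset.prod_range_succ, ← qWallis]
  exact le_mul_of_one_le_right
    (Finset.prod_nonneg fun m _ => zero_le_one.trans (one_le_qWallis_factor hq0 hq1 m))
    (one_le_qWallis_factor hq0 hq1 N)

theorem tendsto_qWallis {q : ℝ} (hq0 : 0 < q) (hq1 : q < 1) :
    Tendsto (fun N => (1 + q) * qWallis q N) atTop (𝓝 (qGamma (q ^ 2) (1 / 2) ^ 2)) := by
  have hp0 : 0 ≤ q ^ 2 := sq_nonneg q
  have hp1 : q ^ 2 < 1 := by nlinarith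
  have hU := (qPochInf_pos hq0.le hq1 hp0 hp1).ne'
  have hu := tendsto_qPoch (a := q) hp0 hp1
  have hv := tendsto_qPoch (a := q ^ 2) hp0 hp1
  have h := (((hv.pow 2).const_mul (1 - q)).div (hu.mul ((tendsto_add_atTop_iff_nat 1).2 hu))
    (mul_ne_zero hU hU)).const_mul (1 + q)
  rw [qGamma_half_sq hq0 hq1]
  convert! h using 2 with N
  · rw [qWallis_eq hq0.le hq1]
    rfl
  · field_simp
    ring

theorem tendsto_qWallis_left_one (N : ℕ) :
    Tendsto (fun q => (1 + q) * qWallis q N) (𝓝[<] 1) (𝓝 (2 * Real.Wallis.W N)) := by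
  have h : ∀ m : ℕ, Tendsto (fun q : ℝ => (1 - q ^ (2 * m + 2)) ^ 2
      / ((1 - q ^ (2 * m + 1)) * (1 - q ^ (2 * m + 3)))) (𝓝[<] 1)
      (𝓝 ((2 * m + 2) / (2 * m + 1) * ((2 * m + 2) / (2 * m + 3)) : ℝ)) := fun m => by
    have hs : ∀ n, 0 < n → (∑ i ∈ Finset.range n, (1 : ℝ) ^ i) ≠ 0 := fun n hn => by
      simp [hn.ne']
    refine tendsto_left_one_of_eq (g := fun q => (∑ i ∈ Finset.range (2 * m + 2), q ^ i) ^ 2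
      / ((∑ i ∈ Finset.range (2 * m + 1), q ^ i) * ∑ i ∈ Finset.range (2 * m + 3), q ^ i))
      (fun q _ hq1 => ?_) ?_ ?_
    · have h1 : 1 - q ≠ 0 := by linarith
      simp only [← mul_neg_geom_sum]
      refine Eq.trans ?_ (mul_div_mul_left _ _ (pow_ne_zero 2 h1))
      congr 1 <;> ring
    · exact ContinuousAt.div (by fun_prop) (by fun_prop)
        (mul_ne_zero (hs _ (by omega)) (hs _ (by omega)))
    · simp
      field_simp
  have h1 : Tendsto (fun q : ℝ => 1 + q) (𝓝[<] 1) (𝓝 2) :=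
    tendsto_left_one_of_eq (fun _ _ _ => rfl) (by fun_prop) (by norm_num)
  exact h1.mul (tendsto_finsetProd _ fun m _ => h m)

/-- Monotonicity in `N` replaces uniform convergence. From below, a fixed partial product bounds the
value and tends to `2 * W N`, which is close to `π` for large `N`; from above, the value is at most
`(1 + q) * (π / 2) < π`. -/
theorem tendsto_qGamma_half_sq :
    Tendsto (fun q : ℝ => qGamma (q ^ 2) (1 / 2) ^ 2) (𝓝[<] 1) (𝓝 Real.pi) := by
  have hmem : ∀ᶠ q : ℝ in 𝓝[<] 1, q ∈ Set.Ioo (0 : ℝ) 1 := Ioo_mem_nhdsLT zero_lt_one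
  refine tendsto_order.2 ⟨fun a ha => ?_, fun a ha => ?_⟩
  · obtain ⟨N, hN⟩ := ((Real.Wallis.tendsto_W_nhds_pi_div_two.const_mul 2).eventually
      (lt_mem_nhds (show a < 2 * (Real.pi / 2) by linarith))).exists
    filter_upwards [hmem, (tendsto_qWallis_left_one N).eventually (lt_mem_nhds hN)] with q hq hlt
    refine hlt.trans_le ((Monotone.ge_of_tendsto (fun i j hij => ?_)
      (tendsto_qWallis hq.1 hq.2)) N)
    exact mul_le_mul_of_nonneg_left (monotone_qWallis hq.1.le hq.2 hij) (by linarith [hq.1])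
  · filter_upwards [hmem] with q hq
    refine lt_of_le_of_lt (le_of_tendsto' (tendsto_qWallis hq.1 hq.2) fun N => ?_) ha
    have := qWallis_le hq.1.le hq.2 N
    nlinarith [hq.1, hq.2, Real.pi_pos]

theorem tendsto_inv_qGamma_half (c : ℝ) :
    Tendsto (fun q : ℝ => c * (1 / qGamma (q ^ 2) (1 / 2) ^ 4)) (𝓝[<] 1)
      (𝓝 (c / Real.pi ^ 2)) := by
  have h := ((tendsto_qGamma_half_sq.pow 2).inv₀ (pow_ne_zero 2 Real.pi_ne_zero)).const_mul c
  simp only [← pow_mul] at h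
  simpa [div_eq_mul_inv] using h

end QRamanujan

end

theorem mainTheorem3 :
    (∀ q : ℝ, 0 < q → q < 1 →
      HasSum (QRamanujan.S₁ q) ((1 - q ^ 2) ^ 2 / QRamanujan.qGamma (q ^ 2) (1 / 2) ^ 4) ∧
      HasSum (QRamanujan.S₂ q) ((1 - q ^ 2) ^ 2 / QRamanujan.qGamma (q ^ 2) (1 / 2) ^ 4) ∧
      HasSum (QRamanujan.S₃ q) ((1 - q ^ 2) ^ 2 / QRamanujan.qGamma (q ^ 2) (1 / 2) ^ 4)) ∧
    (∀ n : ℕ,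
      Tendsto (fun q : ℝ => 8 * (QRamanujan.S₁ q n / (1 - q ^ 2) ^ 2))
        (𝓝[<] 1) (𝓝 (QRamanujan.R₁ n)) ∧
      Tendsto (fun q : ℝ => 128 * (QRamanujan.S₂ q n / (1 - q ^ 2) ^ 2))
        (𝓝[<] 1) (𝓝 (QRamanujan.R₂ n)) ∧
      Tendsto (fun q : ℝ => 32 * (QRamanujan.S₃ q n / (1 - q ^ 2) ^ 2))
        (𝓝[<] 1) (𝓝 (QRamanujan.R₃ n))) ∧
    Tendsto (fun q : ℝ => 8 * (1 / QRamanujan.qGamma (q ^ 2) (1 / 2) ^ 4))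
      (𝓝[<] 1) (𝓝 (8 / Real.pi ^ 2)) ∧
    Tendsto (fun q : ℝ => 128 * (1 / QRamanujan.qGamma (q ^ 2) (1 / 2) ^ 4))
      (𝓝[<] 1) (𝓝 (128 / Real.pi ^ 2)) ∧
    Tendsto (fun q : ℝ => 32 * (1 / QRamanujan.qGamma (q ^ 2) (1 / 2) ^ 4))
      (𝓝[<] 1) (𝓝 (32 / Real.pi ^ 2)) :=
  ⟨fun _ hq0 hq1 => ⟨QRamanujan.hasSum_S₁ hq0 hq1, QRamanujan.hasSum_S₂ hq0 hq1,
      QRamanujan.hasSum_S₃ hq0 hq1⟩,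
    fun n => ⟨QRamanujan.tendsto_S₁ n, QRamanujan.tendsto_S₂ n, QRamanujan.tendsto_S₃ n⟩,
    QRamanujan.tendsto_inv_qGamma_half 8, QRamanujan.tendsto_inv_qGamma_half 128,
    QRamanujan.tendsto_inv_qGamma_half 32⟩
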